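/- Let $M/F$ be a finite Galois field extension of degree $n$ with abelian Galois group $G$, and let $\{1\}=G_0\le G_1\le\dots\le G_k=G$ be a chain of subgroups such that $G_{i+1}/G_i$ is cyclic of prime order $q_i$, generated by the class of $\sigma_{i+1}\in G_{i+1}$ ($0\le i<k$). Write $\sigma_{i+1}^{q_i}=\prod_{j<i}\sigma_{j+1}^{e_{ij}}$ with $0\le e_{ij}<q_j$, and let $l_0,\dots,l_{k-1}\in F^\times$. For a ring $S$ and an automorphism $\tau$ of $S$, $S[t;\tau]$ denotes the ring of polynomials $\sum_j a_jt^j$ ($a_j\in S$) with $ta=\tau(a)t$. Starting from $A_0=M$, put $$A_{i+1}=A_i[t_i;\tau_i]/A_i[t_i;\tau_i](t_i^{q_i}-c_i),\qquad c_i=l_i\,t_0^{e_{i0}}\cdots t_{i-1}^{e_{i,i-1}}\in A_i\quad(c_0=l_0),$$ where $\tau_i$ is the automorphism of $A_i$ that acts as $\sigma_{i+1}$ on $M$ and fixes $t_0,\dots,t_{i-1}$. Then: 1. For $0\le i<k$: $\tau_i|_M=\sigma_{i+1}$; $c_i$ is invertible and $\tau_i(c_i)=c_i$; the left ideal generated by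 $t_i^{q_i}-c_i$ is two-sided; $A_i$ is simple and finite-dimensional over its centre, and $\tau_i$ has order exactly $q_i$ on that centre, so that $A_{i+1}$ is the generalised cyclic algebra $(A_i,\tau_i,c_i)$; $A_i\to A_{i+1}$ is injective; and $\mathrm{Cent}(A_i)\cap\mathrm{Fix}(\tau_i)=\{m\in M : \sigma_{j+1}(m)=m\text{ for all }0\le j\le i\}$. Moreover $\dim_F A_i=n\prod_{j<i}q_j$ for $0\le i\le k$. 2. For $0\le i<k$, $\tau_i$ has inner order $q_i$, that is, $q_i$ is the least positive integer $r$ such that $\tau_i^r$ is conjugation by a unit of $A_i$. 3. $\mathrm{Cent}(A_k)=F$, $\dim_F A_k=n^2$, and $M\to A_k$ is injective. 4. If $0\le i\le k$ and, for every $j<i$, $\tau_j^{q_j-1}(z)\cdots\tau_j(z)\,z\ne c_j$ for all $z\in A_j$, then $A_i$ is a division algebra. In particular, if this holds for all $j<k$, then $A_k$ is a division algebra and a $G$-crossed product algebra over $F$, i.e. a central simple $F$-algebra of degree $n$ that contains the Galois extension $M/F$ of degree $n$ and group $G$. -/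

import Mathlib

universe u v w

namespace CyclicTower

noncomputable section

/-! ### Twisted polynomial rings `S[t; τ]` and their quotients by `t ^ q - c` -/

section Twisted

variable {F : Type u} [Field F] {S : Type v} [Ring S] [Algebra F S]

/-- A copy of the coefficient ring `S`, on which `n : ℕ` acts as `τ ^ n`. -/
def Coeff (_τ : S ≃ₐ[F] S) : Type v := S

instance (τ : S ≃ₐ[F] S) : Ring (Coeff τ) := inferInstanceAs (Ring S)

instance (τ : S ≃ₐ[F] S) : Algebra F (Coeff τ) := inferInstanceAs (Algebra F S)

instance (τ : S ≃ₐ[F] S) : MulSemiringAction (Multiplicative ℕ) (Coeff τ) where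
  smul n s := (τ ^ n.toAdd : S ≃ₐ[F] S) s
  one_smul _ := rfl
  mul_smul m n s := by
    change (τ ^ (m.toAdd + n.toAdd) : S ≃ₐ[F] S) s = _
    rw [pow_add]; rfl
  smul_zero n := map_zero (τ ^ n.toAdd : S ≃ₐ[F] S)
  smul_add n := map_add (τ ^ n.toAdd : S ≃ₐ[F] S)
  smul_one n := map_one (τ ^ n.toAdd : S ≃ₐ[F] S)
  smul_mul n := map_mul (τ ^ n.toAdd : S ≃ₐ[F] S)

instance (τ : S ≃ₐ[F] S) : SMulCommClass (Multiplicative ℕ) F (Coeff τ) where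
  smul_comm n a s := map_smul (τ ^ n.toAdd : S ≃ₐ[F] S) a s

/-- The twisted polynomial ring `S[t; τ]`: left polynomials `∑ aⱼ tʲ`, with `t a = τ(a) t`. -/
abbrev TwistedPoly (τ : S ≃ₐ[F] S) : Type v := SkewPolynomial (Coeff τ)

/-- The constant polynomials in `S[t; τ]`. -/
def const (τ : S ≃ₐ[F] S) : S →ₐ[F] TwistedPoly τ where
  __ := (SkewPolynomial.CRingHom : Coeff τ →+* SkewPolynomial (Coeff τ))
  commutes' _ := rfl

/-- The indeterminate `t` of `S[t; τ]`. -/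
def indet (τ : S ≃ₐ[F] S) : TwistedPoly τ := SkewPolynomial.X

theorem indet_mul_const (τ : S ≃ₐ[F] S) (a : S) :
    indet τ * const τ a = const τ (τ a) * indet τ := by
  have key : ∀ b : Coeff τ, (SkewPolynomial.X : TwistedPoly τ) * SkewPolynomial.C b
      = SkewPolynomial.C (SkewPolynomial.φ b) * SkewPolynomial.X := fun b => by
    rw [← SkewPolynomial.monomial_zero_left, ← SkewPolynomial.monomial_zero_left,
      SkewPolynomial.X_mul_monomial, SkewPolynomial.monomial_mul_X]
  exact key a

/-- The binomial `t ^ q - c` in `S[t; τ]`. -/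
def binom (τ : S ≃ₐ[F] S) (q : ℕ) (c : S) : TwistedPoly τ := indet τ ^ q - const τ c

/-- The two-sided ideal of `S[t; τ]` generated by `t ^ q - c`. It coincides with the left ideal
`S[t; τ] (t ^ q - c)` as soon as `t ^ q - c` is right invariant (see `IsRightInvariant`). -/
def binomIdeal (τ : S ≃ₐ[F] S) (q : ℕ) (c : S) : Ideal (TwistedPoly τ) :=
  (TwoSidedIdeal.span {binom τ q c}).asIdeal

instance (τ : S ≃ₐ[F] S) (q : ℕ) (c : S) : (binomIdeal τ q c).IsTwoSided :=
  inferInstanceAs (TwoSidedIdeal.asIdeal _).IsTwoSided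

/-- The algebra `S[t; τ] / (t ^ q - c)`. -/
abbrev CyclicQuot (τ : S ≃ₐ[F] S) (q : ℕ) (c : S) : Type v := TwistedPoly τ ⧸ binomIdeal τ q c

/-- A polynomial `f` is right invariant if the left ideal `S[t; τ] f` is two-sided. -/
def IsRightInvariant {τ : S ≃ₐ[F] S} (f : TwistedPoly τ) : Prop :=
  (Ideal.span {f}).IsTwoSided

/-- The canonical map `S → S[t; τ] / (t ^ q - c)`. -/
def ofCoeff (τ : S ≃ₐ[F] S) (q : ℕ) (c : S) : S →ₐ[F] CyclicQuot τ q c :=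
  (Ideal.Quotient.mkₐ F (binomIdeal τ q c)).comp (const τ)

/-- The class of `t` in `S[t; τ] / (t ^ q - c)`. -/
def gen (τ : S ≃ₐ[F] S) (q : ℕ) (c : S) : CyclicQuot τ q c :=
  Ideal.Quotient.mkₐ F (binomIdeal τ q c) (indet τ)

theorem gen_mul_ofCoeff (τ : S ≃ₐ[F] S) (q : ℕ) (c a : S) :
    gen τ q c * ofCoeff τ q c a = ofCoeff τ q c (τ a) * gen τ q c := by
  simp only [gen, ofCoeff, AlgHom.comp_apply, ← map_mul, indet_mul_const]

theorem gen_pow (τ : S ≃ₐ[F] S) (q : ℕ) (c : S) :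
    gen τ q c ^ q = ofCoeff τ q c c := by
  simp only [gen, ofCoeff, AlgHom.comp_apply, ← map_pow]
  refine (Ideal.Quotient.mk_eq_mk_iff_sub_mem _ _).2 ?_
  exact TwoSidedIdeal.mem_asIdeal.2 (TwoSidedIdeal.subset_span rfl)

section Lift

variable {B : Type w} [Ring B] [Algebra F B]

theorem pow_mul_apply {τ : S ≃ₐ[F] S} {f : S →ₐ[F] B} {x : B}
    (h : ∀ s, x * f s = f (τ s) * x) (n : ℕ) (s : S) :
    x ^ n * f s = f ((τ ^ n : S ≃ₐ[F] S) s) * x ^ n := by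
  induction n generalizing s with
  | zero => simp
  | succ n ih => rw [pow_succ, mul_assoc, h, ← mul_assoc, ih, mul_assoc, pow_succ]; rfl

/-- Evaluation `∑ aⱼ tʲ ↦ ∑ f(aⱼ) xʲ` on `S[t; τ]`. -/
def evalPoly (τ : S ≃ₐ[F] S) (f : S →ₐ[F] B) (x : B) (h : ∀ s, x * f s = f (τ s) * x) :
    TwistedPoly τ →ₐ[F] B :=
  SkewMonoidAlgebra.liftNCAlgHom (A := Coeff τ) (show Coeff τ →ₐ[F] B from f) (powersHom B x)
    (fun {s n} => (pow_mul_apply h n.toAdd s).symm)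

theorem evalPoly_const (τ : S ≃ₐ[F] S) (f : S →ₐ[F] B) (x : B)
    (h : ∀ s, x * f s = f (τ s) * x) (s : S) : evalPoly τ f x h (const τ s) = f s := by
  refine (SkewMonoidAlgebra.liftNC_single _ _ _ _).trans ?_
  simp
  rfl

theorem evalPoly_indet (τ : S ≃ₐ[F] S) (f : S →ₐ[F] B) (x : B)
    (h : ∀ s, x * f s = f (τ s) * x) : evalPoly τ f x h (indet τ) = x := by
  refine (SkewMonoidAlgebra.liftNC_single _ _ _ _).trans ?_
  simp

/-- Evaluation `∑ aⱼ tʲ ↦ ∑ f(aⱼ) xʲ` on `S[t; τ] / (t ^ q - c)`. -/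
def evalQuot (τ : S ≃ₐ[F] S) (q : ℕ) (c : S) (f : S →ₐ[F] B) (x : B)
    (h : ∀ s, x * f s = f (τ s) * x) (hq : x ^ q = f c) : CyclicQuot τ q c →ₐ[F] B :=
  Ideal.Quotient.liftₐ (binomIdeal τ q c) (evalPoly τ f x h) (by
    have hle : TwoSidedIdeal.span {binom τ q c} ≤ TwoSidedIdeal.ker (evalPoly τ f x h) := by
      rw [TwoSidedIdeal.span_le, Set.singleton_subset_iff]
      change _ ∈ TwoSidedIdeal.ker (evalPoly τ f x h)
      rw [TwoSidedIdeal.mem_ker, binom, map_sub, map_pow, evalPoly_const, evalPoly_indet, hq,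
        sub_self]
    intro a ha
    exact (TwoSidedIdeal.mem_ker _).1 (hle (TwoSidedIdeal.mem_asIdeal.1 ha)))

@[simp]
theorem evalQuot_ofCoeff (τ : S ≃ₐ[F] S) (q : ℕ) (c : S) (f : S →ₐ[F] B) (x : B)
    (h : ∀ s, x * f s = f (τ s) * x) (hq : x ^ q = f c) (s : S) :
    evalQuot τ q c f x h hq (ofCoeff τ q c s) = f s :=
  evalPoly_const τ f x h s

@[simp]
theorem evalQuot_gen (τ : S ≃ₐ[F] S) (q : ℕ) (c : S) (f : S →ₐ[F] B) (x : B)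
    (h : ∀ s, x * f s = f (τ s) * x) (hq : x ^ q = f c) :
    evalQuot τ q c f x h hq (gen τ q c) = x :=
  evalPoly_indet τ f x h

theorem quot_algHom_ext {τ : S ≃ₐ[F] S} {q : ℕ} {c : S} {φ ψ : CyclicQuot τ q c →ₐ[F] B}
    (h₁ : ∀ s, φ (ofCoeff τ q c s) = ψ (ofCoeff τ q c s))
    (h₂ : φ (gen τ q c) = ψ (gen τ q c)) : φ = ψ := by
  refine Ideal.Quotient.algHom_ext F (AlgHom.ext fun p => ?_)
  induction p using SkewPolynomial.induction with
  | h0 => simp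
  | ha n r p _ _ ih =>
    rw [map_add, map_add, ih]
    congr 1
    have hm : SkewPolynomial.monomial n r = const τ r * indet τ ^ n := by
      change _ = SkewPolynomial.C (R := Coeff τ) r * SkewPolynomial.X ^ n
      rw [← SkewPolynomial.monomial_zero_left, SkewPolynomial.monomial_mul_X_pow, zero_add]
    rw [hm, map_mul, map_mul, map_pow, map_pow]
    exact congrArg₂ (fun a b => a * b ^ n) (h₁ r) h₂

end Lift

end Twisted

/-! ### The iterated construction -/

section Tower

variable (F : Type u) (M : Type v) [Field F] [Field M] [Algebra F M]

/-- One level `A` of the tower: an `F`-algebra with a map `M → A`, the elements `t j` adjoined so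
far, and, for each `ρ` in the Galois group, the automorphism `H_ρ = act ρ` of `A`. It only
organises the recursion; the levels that are used are the concrete algebras in `tower`. -/
structure Level where
  /-- the algebra -/
  A : Type v
  [ring : Ring A]
  [algebra : Algebra F A]
  /-- the canonical map from `M` -/
  ofField : M →ₐ[F] A
  /-- the automorphisms `H_ρ` -/
  act : Gal(M/F) →* (A ≃ₐ[F] A)
  /-- the elements adjoined so far (and `1` for the indices not yet reached) -/
  t : ℕ → A
  act_t : ∀ ρ j, act ρ (t j) = t j

attribute [instance] Level.ring Level.algebra

variable {F M}

/-- The bottom level `M`, on which `H_ρ = ρ`. -/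
def Level.base : Level F M where
  A := M
  ofField := AlgHom.id F M
  act := MonoidHom.id _
  t _ := 1
  act_t ρ _ := map_one ρ

/-- The element `l t₀ ^ e₀ ⋯ tᵢ₋₁ ^ eᵢ₋₁`. -/
def Level.element (L : Level F M) (l : F) (e : ℕ → ℕ) (i : ℕ) : L.A :=
  algebraMap F L.A l * ((List.range i).map fun j => L.t j ^ e j).prod

theorem Level.act_element (L : Level F M) (l : F) (e : ℕ → ℕ) (i : ℕ) (ρ : Gal(M/F)) :
    L.act ρ (L.element l e i) = L.element l e i := by
  simp only [Level.element, map_mul, AlgEquiv.commutes, map_list_prod, List.map_map]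
  congr 3
  funext j
  simp [L.act_t]

variable [IsMulCommutative Gal(M/F)]

theorem Level.act_comm (L : Level F M) (ρ σ : Gal(M/F)) (a : L.A) :
    L.act ρ (L.act σ a) = L.act σ (L.act ρ a) := by
  rw [← AlgEquiv.mul_apply, ← AlgEquiv.mul_apply, ← map_mul, ← map_mul, mul_comm' ρ σ]

/-- The endomorphism `∑ aⱼ tʲ ↦ ∑ H_ρ(aⱼ) tʲ` of `A[t; H_σ] / (t ^ q - c)`. -/
def Level.extend (L : Level F M) (σ : Gal(M/F)) (q : ℕ) (c : L.A)
    (hc : ∀ ρ, L.act ρ c = c) (ρ : Gal(M/F)) :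
    CyclicQuot (L.act σ) q c →ₐ[F] CyclicQuot (L.act σ) q c :=
  evalQuot (L.act σ) q c ((ofCoeff (L.act σ) q c).comp (L.act ρ).toAlgHom) (gen (L.act σ) q c)
    (fun s => by
      change _ * ofCoeff _ q c (L.act ρ s) = ofCoeff _ q c (L.act ρ (L.act σ s)) * _
      rw [gen_mul_ofCoeff, L.act_comm])
    (by
      change _ = ofCoeff _ q c (L.act ρ c)
      rw [hc, gen_pow])

/-- The passage from `A` to `A[t; H_σ] / (t ^ q - c)`. -/
def Level.adjoin (L : Level F M) (i : ℕ) (σ : Gal(M/F)) (q : ℕ) (c : L.A)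
    (hc : ∀ ρ, L.act ρ c = c) : Level F M where
  A := CyclicQuot (L.act σ) q c
  ofField := (ofCoeff (L.act σ) q c).comp L.ofField
  act := (AlgEquiv.algHomUnitsEquiv F _).toMonoidHom.comp
    (MonoidHom.toHomUnits
      { toFun := L.extend σ q c hc
        map_one' := quot_algHom_ext (by simp [Level.extend]) (by simp [Level.extend])
        map_mul' := fun ρ ρ' =>
          quot_algHom_ext (by simp [Level.extend]) (by simp [Level.extend]) })
  t := Function.update (fun j => ofCoeff (L.act σ) q c (L.t j)) i (gen (L.act σ) q c)
  act_t ρ j := by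
    change L.extend σ q c hc ρ _ = _
    rcases eq_or_ne j i with rfl | h
    · simp [Level.extend]
    · simp [Level.extend, h, L.act_t]

theorem Level.extend_ofCoeff (L : Level F M) (σ : Gal(M/F)) (q : ℕ) (c : L.A)
    (hc : ∀ ρ, L.act ρ c = c) (ρ : Gal(M/F)) (x : L.A) :
    L.extend σ q c hc ρ (ofCoeff (L.act σ) q c x) = ofCoeff (L.act σ) q c (L.act ρ x) :=
  evalQuot_ofCoeff _ _ _ _ _ _ _ _

theorem Level.extend_gen (L : Level F M) (σ : Gal(M/F)) (q : ℕ) (c : L.A)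
    (hc : ∀ ρ, L.act ρ c = c) (ρ : Gal(M/F)) :
    L.extend σ q c hc ρ (gen (L.act σ) q c) = gen (L.act σ) q c :=
  evalQuot_gen _ _ _ _ _ _ _

/-- The tower `M = A₀, A₁, A₂, …` with `Aᵢ₊₁ = Aᵢ[tᵢ; τᵢ] / (tᵢ ^ qᵢ - cᵢ)`, where
`τᵢ = H_{σᵢ}` and `cᵢ = lᵢ t₀ ^ eᵢ₀ ⋯ tᵢ₋₁ ^ eᵢ,ᵢ₋₁`. -/
def tower (σ : ℕ → Gal(M/F)) (q : ℕ → ℕ) (e : ℕ → ℕ → ℕ) (l : ℕ → Fˣ) : ℕ → Level F M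
  | 0 => Level.base
  | i + 1 =>
    (tower σ q e l i).adjoin i (σ i) (q i) ((tower σ q e l i).element (l i) (e i) i)
      ((tower σ q e l i).act_element (l i) (e i) i)

/-- The algebra `Aᵢ`. -/
abbrev Alg (σ : ℕ → Gal(M/F)) (q : ℕ → ℕ) (e : ℕ → ℕ → ℕ) (l : ℕ → Fˣ) (i : ℕ) : Type v :=
  (tower σ q e l i).A

/-- The automorphism `τᵢ` of `Aᵢ`, which acts as `σᵢ` on `M` and fixes `t₀, …, tᵢ₋₁`. -/
abbrev tau (σ : ℕ → Gal(M/F)) (q : ℕ → ℕ) (e : ℕ → ℕ → ℕ) (l : ℕ → Fˣ) (i : ℕ) :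
    Alg σ q e l i ≃ₐ[F] Alg σ q e l i :=
  (tower σ q e l i).act (σ i)

/-- The element `cᵢ = lᵢ t₀ ^ eᵢ₀ ⋯ tᵢ₋₁ ^ eᵢ,ᵢ₋₁` of `Aᵢ`; in particular `c₀ = l₀`. -/
abbrev elt (σ : ℕ → Gal(M/F)) (q : ℕ → ℕ) (e : ℕ → ℕ → ℕ) (l : ℕ → Fˣ) (i : ℕ) :
    Alg σ q e l i :=
  (tower σ q e l i).element (l i) (e i) i

/-- The canonical map `M → Aᵢ`. -/
abbrev incl (σ : ℕ → Gal(M/F)) (q : ℕ → ℕ) (e : ℕ → ℕ → ℕ) (l : ℕ → Fˣ) (i : ℕ) :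
    M →ₐ[F] Alg σ q e l i :=
  (tower σ q e l i).ofField

/-- The canonical map `Aᵢ → Aᵢ₊₁`. -/
def inclSucc (σ : ℕ → Gal(M/F)) (q : ℕ → ℕ) (e : ℕ → ℕ → ℕ) (l : ℕ → Fˣ) (i : ℕ) :
    Alg σ q e l i →ₐ[F] Alg σ q e l (i + 1) :=
  ofCoeff (tau σ q e l i) (q i) (elt σ q e l i)

end Tower

/-! ### The notions in the statement -/

section Notions

variable {F : Type u} [Field F] {S : Type v} [Ring S] [Algebra F S]

/-- `φ` is inner: `φ x = u x u⁻¹` for some unit `u`. -/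
def IsInner (φ : S ≃ₐ[F] S) : Prop := ∃ u : Sˣ, ∀ x, φ x = u * x * (↑u⁻¹ : S)

/-- `m` is the least positive integer such that `φ ^ m` is inner. -/
def HasInnerOrder (φ : S ≃ₐ[F] S) (m : ℕ) : Prop :=
  IsLeast {n : ℕ | 0 < n ∧ IsInner (φ ^ n)} m

/-- `twistedNorm τ z m = τ ^ (m - 1) (z) ⋯ τ(z) z`, the value of `tᵐ` at `z`. -/
def twistedNorm (τ : S ≃ₐ[F] S) (z : S) : ℕ → S
  | 0 => 1
  | m + 1 => (τ ^ m) z * twistedNorm τ z m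

/-- `S` is simple and finite over its centre `C`, `τ` restricts to an automorphism of `C` of order
`m`, `a` is a unit fixed by `τ`, and `t ^ m - a` is right invariant; that is to say,
`S[t; τ] / S[t; τ] (t ^ m - a)` is the generalised cyclic algebra `(S, τ, a)`. -/
structure IsGeneralisedCyclic (τ : S ≃ₐ[F] S) (m : ℕ) (a : S) : Prop where
  simple : IsSimpleRing S
  finite : Module.Finite (Subalgebra.center F S) S
  order : IsLeast {n : ℕ | 0 < n ∧ ∀ z ∈ Subalgebra.center F S, (τ ^ n) z = z} m
  isUnit : IsUnit a
  fixed : τ a = a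
  rightInvariant : IsRightInvariant (binom τ m a)

/-- A division algebra: nonzero, and all multiplications by nonzero elements are bijective. -/
def IsDivisionAlgebra (A : Type v) [Ring A] : Prop :=
  Nontrivial A ∧ ∀ a : A, a ≠ 0 →
    Function.Bijective (fun x => a * x) ∧ Function.Bijective (fun x => x * a)

/-- `A` is a crossed product algebra over `F` for the group `Gal(M/F)`: it is central simple over
`F` of degree `n = [M : F]` and contains the Galois extension `M` of `F`, via `f`. -/
structure IsCrossedProduct {M : Type w} [Field M] [Algebra F M] {A : Type v} [Ring A] [Algebra F A]
    (f : M →ₐ[F] A) : Prop where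
  central : Algebra.IsCentral F A
  simple : IsSimpleRing A
  galois : IsGalois F M
  finite : FiniteDimensional F M
  degree : Module.finrank F A = Module.finrank F M ^ 2
  injective : Function.Injective f

end Notions

end

end CyclicTower

open CyclicTower

/-! The relation expressing `σ i ^ q i` through the earlier generators says that conjugation by `cᵢ`
is `τᵢ ^ qᵢ`: the two agree on `M` because `tⱼ m = σⱼ(m) tⱼ`, and on each `tⱼ` because the `tⱼ`
commute with each other and are fixed by `τᵢ` (`Level.IsGenerated.act_mul_element`). Hence `t ^ qᵢ -
cᵢ` is right invariant, and `Aᵢ₊₁` is free over `Aᵢ` on `1, t, …, t ^ (qᵢ - 1)`.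

Inductively, `Aᵢ` is simple with centre the fixed field of `Gᵢ` in `M`. Since `qᵢ` is prime, `σᵢ ^ m
∉ Gᵢ` for `0 < m < qᵢ`, so by the Galois correspondence `τᵢ ^ m` moves some central element. This
makes `qᵢ` both the order on the centre and the inner order. It also separates the powers of `t`,
which gives simplicity of `Aᵢ₊₁` (`isSimpleRing_cyclicQuot`) and shows that its centre is the part
of the old centre fixed by `τᵢ`, the fixed field of `Gᵢ₊₁` (`Level.IsSimpleLevel.adjoin`). At the
top the fixed field is `F`, and `∏ qⱼ = |G| = n` gives dimension `n ^ 2`.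

If `Aᵢ` is a division ring, then `Aᵢ₊₁` is simple of prime left dimension over it. Either it is a
division ring, or it has a left ideal `Aᵢ v` of dimension one. In the latter case `t v = z v` for
some `z`, and `cᵢ v = t ^ qᵢ v` forces `cᵢ` to be the twisted norm of `z`. -/

namespace CyclicTower

/-! ### Right invariance of `t ^ q - c` and the basis `1, t, …, t ^ (q - 1)` -/

section Twisted

variable {F : Type u} [Field F] {S : Type v} [Ring S] [Algebra F S]

theorem const_mul_indet_pow (τ : S ≃ₐ[F] S) (a : Coeff τ) (n : ℕ) :
    const τ a * indet τ ^ n = SkewPolynomial.monomial n a := by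
  change SkewPolynomial.C (R := Coeff τ) a * SkewPolynomial.X ^ n = _
  rw [← SkewPolynomial.monomial_zero_left, SkewPolynomial.monomial_mul_X_pow, zero_add]

theorem twistedPoly_induction (τ : S ≃ₐ[F] S) {P : TwistedPoly τ → Prop} (p : TwistedPoly τ)
    (zero : P 0) (add : ∀ p q, P p → P q → P (p + q))
    (monomial : ∀ (n : ℕ) (a : S), P (const τ a * indet τ ^ n)) : P p := by
  induction p using SkewPolynomial.induction with
  | h0 => exact zero
  | ha n r p _ _ ih =>
    refine add _ _ ?_ ih
    rw [← const_mul_indet_pow]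
    exact monomial n r

theorem binom_mul_const {τ : S ≃ₐ[F] S} {q : ℕ} {c : S}
    (hc : ∀ a, (τ ^ q) a * c = c * a) (a : S) :
    binom τ q c * const τ a = const τ ((τ ^ q) a) * binom τ q c := by
  rw [binom, sub_mul, mul_sub, pow_mul_apply (indet_mul_const τ), ← map_mul, ← map_mul, hc]

theorem binom_mul_indet {τ : S ≃ₐ[F] S} {q : ℕ} {c : S} (hfix : τ c = c) :
    binom τ q c * indet τ = indet τ * binom τ q c := by
  rw [binom, sub_mul, mul_sub, indet_mul_const, hfix, pow_mul_comm']

/-- The binomial `f` satisfies `f a = τ ^ q (a) f` and `f t = t f`, so `f` can be moved to the right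
past every monomial. -/
theorem isRightInvariant_binom {τ : S ≃ₐ[F] S} {q : ℕ} {c : S}
    (hfix : τ c = c) (hc : ∀ a, (τ ^ q) a * c = c * a) : IsRightInvariant (binom τ q c) := by
  have hmem : binom τ q c ∈ Ideal.span {binom τ q c} := Ideal.subset_span rfl
  have hpow (n : ℕ) : binom τ q c * indet τ ^ n = indet τ ^ n * binom τ q c :=
    ((show Commute (binom τ q c) (indet τ) from binom_mul_indet hfix).pow_right n).eq
  have key (p : TwistedPoly τ) : binom τ q c * p ∈ Ideal.span {binom τ q c} := by
    induction p using twistedPoly_induction with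
    | zero => simp
    | add p p' hp hp' => rw [mul_add]; exact add_mem hp hp'
    | monomial n a =>
      rw [← mul_assoc, binom_mul_const hc, mul_assoc, hpow, ← mul_assoc]
      exact Ideal.mul_mem_left _ _ hmem
  refine ⟨fun {a} b ha => ?_⟩
  obtain ⟨g, rfl⟩ := Ideal.mem_span_singleton'.1 ha
  rw [mul_assoc]
  exact Ideal.mul_mem_left _ _ (key b)

theorem mem_binomIdeal {τ : S ≃ₐ[F] S} {q : ℕ} {c : S}
    (h : IsRightInvariant (binom τ q c)) {p : TwistedPoly τ} :
    p ∈ binomIdeal τ q c ↔ ∃ g, g * binom τ q c = p := by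
  constructor
  · intro hp
    have : (Ideal.span {binom τ q c}).IsTwoSided := h
    have hle : TwoSidedIdeal.span {binom τ q c} ≤ (Ideal.span {binom τ q c}).toTwoSided := by
      rw [TwoSidedIdeal.span_le, Set.singleton_subset_iff]
      exact Ideal.mem_toTwoSided.2 (Ideal.subset_span rfl)
    exact Ideal.mem_span_singleton'.1 (Ideal.mem_toTwoSided.1 (hle (TwoSidedIdeal.mem_asIdeal.1 hp)))
  · rintro ⟨g, rfl⟩
    exact Ideal.mul_mem_left _ _ (TwoSidedIdeal.mem_asIdeal.2 (TwoSidedIdeal.subset_span rfl))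

/-- The coefficient of `tⁿ` in a polynomial in `S[t; τ]`. -/
noncomputable def tcoeff (τ : S ≃ₐ[F] S) (n : ℕ) : TwistedPoly τ →+ S where
  toFun p := SkewPolynomial.coeff p n
  map_zero' := rfl
  map_add' p p' := SkewPolynomial.coeff_add p p' n

theorem tcoeff_const_mul_indet_pow (τ : S ≃ₐ[F] S) (a : S) (n m : ℕ) :
    tcoeff τ m (const τ a * indet τ ^ n) = if n = m then a else 0 := by
  have key (b : Coeff τ) :
      SkewPolynomial.coeff (const τ b * indet τ ^ n) m = if n = m then b else 0 := by
    rw [const_mul_indet_pow, SkewPolynomial.coeff_monomial]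
  exact key a

theorem tcoeff_mul_binom_add (τ : S ≃ₐ[F] S) (q : ℕ) (c : S) (g : TwistedPoly τ) (n : ℕ) :
    tcoeff τ (n + q) (g * binom τ q c) =
      tcoeff τ n g - tcoeff τ (n + q) g * (τ ^ (n + q)) c := by
  rw [binom, mul_sub, map_sub]
  congr 1
  · have : indet τ ^ q = SkewMonoidAlgebra.single (Multiplicative.ofAdd q) (1 : Coeff τ) :=
      (SkewPolynomial.monomial_one_right_eq_X_pow q).symm
    rw [this]
    refine (SkewMonoidAlgebra.coeff_mul_single_aux g
      (y := Multiplicative.ofAdd n) fun a => ?_).trans ?_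
    · rw [ofAdd_add, mul_left_inj]
    · rw [smul_one, mul_one]; rfl
  · exact SkewMonoidAlgebra.coeff_mul_single_aux g (x := 1)
      (y := Multiplicative.ofAdd (n + q)) fun a => by rw [mul_one]

/-- The binomial is monic of degree `q`, so the leading coefficient of a nonzero `g` of degree `n`
survives in degree `n + q` of the product. -/
theorem eq_zero_of_tcoeff_mul_binom_eq_zero {τ : S ≃ₐ[F] S} {q : ℕ} {c : S} (hq : 0 < q)
    (g : TwistedPoly τ) (h : ∀ n, q ≤ n → tcoeff τ n (g * binom τ q c) = 0) : g = 0 := by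
  by_contra hg
  have hne : (SkewPolynomial.support g).Nonempty := by
    rwa [Finset.nonempty_iff_ne_empty, Ne, SkewPolynomial.support_eq_empty]
  set n := (SkewPolynomial.support g).max' hne
  have hn : tcoeff τ n g ≠ 0 := SkewPolynomial.mem_support_iff.1 (Finset.max'_mem _ hne)
  have hnq : tcoeff τ (n + q) g = 0 := by
    by_contra h'
    have : n + q ≤ n := Finset.le_max' _ _ (SkewPolynomial.mem_support_iff.2 h')
    omega
  have := h (n + q) (Nat.le_add_left q n)
  rw [tcoeff_mul_binom_add, hnq, zero_mul, sub_zero] at this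
  exact hn this

/-- The map `(s₀, …, s_{q-1}) ↦ ∑ sⱼ tʲ` to `S[t; τ] / (t ^ q - c)`. -/
noncomputable def combine (τ : S ≃ₐ[F] S) (q : ℕ) (c : S) : (Fin q → S) →ₗ[F] CyclicQuot τ q c where
  toFun s := ∑ j, ofCoeff τ q c (s j) * gen τ q c ^ (j : ℕ)
  map_add' s s' := by simp [add_mul, Finset.sum_add_distrib]
  map_smul' a s := by simp [Finset.smul_sum]

theorem combine_apply (τ : S ≃ₐ[F] S) (q : ℕ) (c : S) (s : Fin q → S) :
    combine τ q c s = ∑ j, ofCoeff τ q c (s j) * gen τ q c ^ (j : ℕ) := rfl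

theorem combine_injective {τ : S ≃ₐ[F] S} {q : ℕ} {c : S} (hq : 0 < q)
    (h : IsRightInvariant (binom τ q c)) : Function.Injective (combine τ q c) := by
  refine (injective_iff_map_eq_zero _).2 fun s hs => ?_
  set p : TwistedPoly τ := ∑ j : Fin q, const τ (s j) * indet τ ^ (j : ℕ) with hp
  have hcoeff (m : ℕ) : tcoeff τ m p = ∑ j : Fin q, if (j : ℕ) = m then s j else 0 := by
    simp only [hp, map_sum, tcoeff_const_mul_indet_pow]
  have hmk : Ideal.Quotient.mkₐ F (binomIdeal τ q c) p = 0 := by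
    rw [← hs, combine_apply, hp, map_sum]
    simp only [map_mul, map_pow]
    rfl
  obtain ⟨g, hg⟩ := (mem_binomIdeal h).1 (Ideal.Quotient.eq_zero_iff_mem.1 hmk)
  -- The representative `p` has degree below `q`, whereas a nonzero left multiple of the binomial
  -- has degree at least `q`.
  have hg0 : g = 0 := by
    refine eq_zero_of_tcoeff_mul_binom_eq_zero (q := q) (c := c) hq g fun n hn => ?_
    rw [hg, hcoeff]
    refine Finset.sum_eq_zero fun j _ => if_neg ?_
    have := j.2
    omega
  rw [hg0, zero_mul] at hg
  funext j
  have := hcoeff j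
  rw [← hg, map_zero, Finset.sum_eq_single j, if_pos rfl] at this
  · exact this.symm
  · intro i _ hij
    exact if_neg fun h => hij (Fin.ext h)
  · simp

theorem combine_surjective {τ : S ≃ₐ[F] S} {q : ℕ} {c : S} (hq : 0 < q) :
    Function.Surjective (combine τ q c) := by
  have hmon (n : ℕ) (a : S) :
      ofCoeff τ q c a * gen τ q c ^ n ∈ LinearMap.range (combine τ q c) := by
    induction n using Nat.strong_induction_on generalizing a with
    | _ n ih =>
      rcases lt_or_ge n q with hn | hn
      · refine ⟨Pi.single ⟨n, hn⟩ a, ?_⟩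
        rw [combine_apply, Finset.sum_eq_single ⟨n, hn⟩]
        · simp
        · intro j _ hj
          rw [Pi.single_eq_of_ne hj, map_zero, zero_mul]
        · simp
      · obtain ⟨m, rfl⟩ := Nat.exists_eq_add_of_le hn
        rw [pow_add, gen_pow, ← mul_assoc, ← map_mul]
        exact ih m (by omega) _
  intro x
  obtain ⟨p, rfl⟩ := Ideal.Quotient.mk_surjective x
  change Ideal.Quotient.mkₐ F (binomIdeal τ q c) p ∈ LinearMap.range (combine τ q c)
  induction p using twistedPoly_induction with
  | zero => rw [map_zero]; exact zero_mem _
  | add p p' hp hp' => rw [map_add]; exact add_mem hp hp'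
  | monomial n a => rw [map_mul, map_pow]; exact hmon n a

end Twisted

/-! ### Simplicity and centre of `S[t; τ] / (t ^ q - c)` -/

section Simple

variable {F : Type u} [Field F] {S : Type v} [Ring S] [Algebra F S]
  {τ : S ≃ₐ[F] S} {q : ℕ} {c : S}

theorem ofCoeff_mul_combine (a : S) (s : Fin q → S) :
    ofCoeff τ q c a * combine τ q c s = combine τ q c fun j => a * s j := by
  simp only [combine_apply, Finset.mul_sum, map_mul, mul_assoc]

theorem combine_mul_ofCoeff (a : S) (s : Fin q → S) :
    combine τ q c s * ofCoeff τ q c a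
      = combine τ q c fun j => s j * (τ ^ (j : ℕ)) a := by
  simp only [combine_apply, Finset.sum_mul, map_mul, mul_assoc,
    pow_mul_apply (gen_mul_ofCoeff τ q c)]

theorem combine_single [NeZero q] (a : S) (j : Fin q) :
    combine τ q c (Pi.single j a) = ofCoeff τ q c a * gen τ q c ^ (j : ℕ) := by
  rw [combine_apply, Finset.sum_eq_single j]
  · simp
  · intro i _ hi
    rw [Pi.single_eq_of_ne hi, map_zero, zero_mul]
  · simp

theorem mem_center_map (φ : S ≃ₐ[F] S) {z : S} (hz : z ∈ Subalgebra.center F S) :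
    φ z ∈ Subalgebra.center F S := by
  rw [Subalgebra.mem_center_iff] at hz ⊢
  intro b
  obtain ⟨a, rfl⟩ := φ.surjective b
  rw [← map_mul, ← map_mul, hz]

/-- The centre of a simple ring is a field. -/
theorem eq_zero_of_central_mul_eq_zero [IsSimpleRing S] {z s : S}
    (hz : z ∈ Subalgebra.center F S) (hz0 : z ≠ 0) (h : z * s = 0) : s = 0 := by
  have hz' : z ∈ Subring.center S :=
    Subring.mem_center_iff.2 fun g => Subalgebra.mem_center_iff.1 hz g
  obtain ⟨w, hw⟩ := (IsSimpleRing.isField_center S).mul_inv_cancel (a := ⟨z, hz'⟩)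
    fun h0 => hz0 (congrArg Subtype.val h0)
  have hw' : z * w = 1 := congrArg Subtype.val hw
  have hzw : (w : S) * z = 1 := by rw [← hw', Subalgebra.mem_center_iff.1 hz]
  rw [← one_mul s, ← hzw, mul_assoc, h, mul_zero]

theorem exists_central_pow_ne
    (hord : ∀ m, 0 < m → m < q → ∃ z ∈ Subalgebra.center F S, (τ ^ m) z ≠ z)
    {i j : Fin q} (hij : i ≠ j) :
    ∃ z ∈ Subalgebra.center F S, (τ ^ (i : ℕ)) z ≠ (τ ^ (j : ℕ)) z := by
  wlog hlt : i < j generalizing i j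
  · obtain ⟨z, hz, hne⟩ := this hij.symm (lt_of_le_of_ne (not_lt.1 hlt) hij.symm)
    exact ⟨z, hz, hne.symm⟩
  obtain ⟨z, hz, hne⟩ := hord (j - i) (by omega) (by omega)
  refine ⟨z, hz, fun h => hne ((τ ^ (i : ℕ)).injective ?_)⟩
  rw [← AlgEquiv.mul_apply, ← pow_add, h]
  congr 2
  omega

theorem isUnit_gen (hq : 0 < q) (hc : IsUnit c) : IsUnit (gen τ q c) := by
  rw [← isUnit_pow_iff hq.ne', gen_pow]
  exact hc.map _

/-- A nonzero element of shortest support in a nonzero ideal has to be a monomial `a t ^ i`. As `t`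
is a unit, the ideal then meets `S` nontrivially. -/
theorem isSimpleRing_cyclicQuot [IsSimpleRing S] (hq : 0 < q) (hc : IsUnit c)
    (hinv : IsRightInvariant (binom τ q c))
    (hord : ∀ m, 0 < m → m < q → ∃ z ∈ Subalgebra.center F S, (τ ^ m) z ≠ z) :
    IsSimpleRing (CyclicQuot τ q c) := by
  classical
  have : NeZero q := ⟨hq.ne'⟩
  have hinj := combine_injective hq hinv
  have : Nontrivial (CyclicQuot τ q c) := hinj.nontrivial
  refine .of_eq_bot_or_eq_top fun I => or_iff_not_imp_left.2 fun hI => ?_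
  rw [← I.one_mem_iff]
  let supp (s : Fin q → S) : Finset (Fin q) := {j | s j ≠ 0}
  let T : Set (Fin q → S) := {s | s ≠ 0 ∧ combine τ q c s ∈ I}
  have hT : T.Nonempty := by
    obtain ⟨x, hx, hx0 : x ≠ 0⟩ := SetLike.exists_of_lt (bot_lt_iff_ne_bot.mpr hI : ⊥ < I)
    obtain ⟨s, rfl⟩ := combine_surjective hq x
    exact ⟨s, fun h => hx0 (by rw [h, map_zero]), hx⟩
  obtain ⟨s, ⟨hs0, hsI⟩, hmin⟩ :=
    WellFounded.has_min (InvImage.wf (fun s => (supp s).card) Nat.lt_wfRel.wf) T hT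
  obtain ⟨i, hi⟩ := Function.ne_iff.1 hs0
  have hsupp : ∀ j, j ≠ i → s j = 0 := by
    intro j hj
    by_contra hsj
    obtain ⟨z, hz, hne⟩ := exists_central_pow_ne hord hj
    -- The coefficients of `τ ^ i (z) x - x z`, for `x` the shortest element: the term at `i`
    -- cancels and the term at `j` survives, so the support shrinks without becoming empty.
    let s' : Fin q → S := fun k => ((τ ^ (i : ℕ)) z - (τ ^ (k : ℕ)) z) * s k
    have hs' : combine τ q c s' =
        ofCoeff τ q c ((τ ^ (i : ℕ)) z) * combine τ q c s
          - combine τ q c s * ofCoeff τ q c z := by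
      rw [ofCoeff_mul_combine, combine_mul_ofCoeff, ← map_sub]
      congr 1
      funext k
      change ((τ ^ (i : ℕ)) z - (τ ^ (k : ℕ)) z) * s k
        = (τ ^ (i : ℕ)) z * s k - s k * (τ ^ (k : ℕ)) z
      rw [sub_mul, Subalgebra.mem_center_iff.1 (mem_center_map (τ ^ (k : ℕ)) hz)]
    refine hmin s' ⟨fun h => hsj ?_, ?_⟩ ?_
    · exact eq_zero_of_central_mul_eq_zero
        (sub_mem (mem_center_map (τ ^ (i : ℕ)) hz) (mem_center_map (τ ^ (j : ℕ)) hz))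
        (sub_ne_zero.2 hne.symm) (congrFun h j)
    · rw [hs']
      exact I.sub_mem (I.mul_mem_left _ _ hsI) (I.mul_mem_right _ _ hsI)
    · refine Finset.card_lt_card (Finset.ssubset_iff_of_subset (fun k hk => ?_) |>.2
        ⟨i, by simpa [supp] using hi, by simp [supp, s']⟩)
      simp only [supp, Finset.mem_filter_univ] at hk ⊢
      exact fun h => hk (by simp [s', h])
  have hs : s = Pi.single i (s i) := by
    funext j
    rcases eq_or_ne j i with rfl | hj
    · simp
    · rw [hsupp j hj, Pi.single_eq_of_ne hj]
  have hmem : s i ∈ TwoSidedIdeal.comap (ofCoeff τ q c) I := by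
    rw [TwoSidedIdeal.mem_comap]
    obtain ⟨u, hu⟩ := (isUnit_gen (τ := τ) hq hc).pow (i : ℕ)
    have := I.mul_mem_right _ (↑u⁻¹ : CyclicQuot τ q c) hsI
    rwa [hs, combine_single, ← hu, Units.mul_inv_cancel_right] at this
  have h1 := IsSimpleRing.one_mem_of_ne_zero_mem _ hi hmem
  rwa [TwoSidedIdeal.mem_comap, map_one] at h1

/-- Commuting with a central `z` of `S` that `τ ^ j` moves kills the coefficient of `t ^ j`, so a
central element lies in `S`. Commuting with `t` then means being fixed by `τ`. -/
theorem mem_center_cyclicQuot_iff [IsSimpleRing S] (hq : 0 < q)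
    (hinv : IsRightInvariant (binom τ q c))
    (hord : ∀ m, 0 < m → m < q → ∃ z ∈ Subalgebra.center F S, (τ ^ m) z ≠ z)
    (hc : IsUnit c) {x : CyclicQuot τ q c} :
    x ∈ Subalgebra.center F (CyclicQuot τ q c) ↔
      ∃ s ∈ Subalgebra.center F S, τ s = s ∧ ofCoeff τ q c s = x := by
  have : NeZero q := ⟨hq.ne'⟩
  have hinj := combine_injective hq hinv
  have hsingle (a : S) : combine τ q c (Pi.single 0 a) = ofCoeff τ q c a := by
    rw [combine_single]; simp
  have hof : Function.Injective (ofCoeff τ q c) := fun a b hab => by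
    rw [← hsingle, ← hsingle] at hab
    exact Pi.single_injective (0 : Fin q) (hinj hab)
  constructor
  · intro hx
    obtain ⟨s, rfl⟩ := combine_surjective hq x
    rw [Subalgebra.mem_center_iff] at hx
    have hs : s = Pi.single 0 (s 0) := by
      funext j
      rcases eq_or_ne j 0 with rfl | hj
      · simp
      · rw [Pi.single_eq_of_ne hj]
        obtain ⟨z, hz, hne⟩ := exists_central_pow_ne hord hj
        have h := hx (ofCoeff τ q c z)
        rw [ofCoeff_mul_combine, combine_mul_ofCoeff] at h
        have hj' := congrFun (hinj h) j
        refine eq_zero_of_central_mul_eq_zero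
          (sub_mem (mem_center_map (τ ^ (j : ℕ)) hz) hz) (sub_ne_zero.2 (by simpa using hne)) ?_
        rw [sub_mul, ← Subalgebra.mem_center_iff.1 (mem_center_map (τ ^ (j : ℕ)) hz), ← hj',
          sub_self]
    rw [hs, hsingle] at hx ⊢
    refine ⟨s 0, ?_, ?_, rfl⟩
    · rw [Subalgebra.mem_center_iff]
      exact fun b => hof (by rw [map_mul, map_mul, hx])
    · have h := hx (gen τ q c)
      rw [gen_mul_ofCoeff] at h
      exact hof ((isUnit_gen hq hc).mul_left_injective h)
  · rintro ⟨s, hs, hfix, rfl⟩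
    rw [Subalgebra.mem_center_iff] at hs ⊢
    have hgen : Commute (gen τ q c) (ofCoeff τ q c s) := by
      rw [commute_iff_eq, gen_mul_ofCoeff, hfix]
    intro b
    obtain ⟨t, rfl⟩ := combine_surjective hq b
    rw [combine_apply]
    refine Commute.sum_left _ _ _ fun j _ => Commute.mul_left ?_ (hgen.pow_left _)
    rw [commute_iff_eq, ← map_mul, ← map_mul, hs]

theorem finite_cyclicQuot [Module.Finite F S] (hq : 0 < q) :
    Module.Finite F (CyclicQuot τ q c) :=
  Module.Finite.of_surjective (combine τ q c) (combine_surjective hq)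

theorem finrank_cyclicQuot [Module.Finite F S] (hq : 0 < q)
    (hinv : IsRightInvariant (binom τ q c)) :
    Module.finrank F (CyclicQuot τ q c) = q * Module.finrank F S := by
  rw [← (LinearEquiv.ofBijective (combine τ q c)
    ⟨combine_injective hq hinv, combine_surjective hq⟩).finrank_eq]
  simp [Module.finrank_pi_fintype]

end Simple

/-! ### The division algebra criterion for one step -/

section Division

/-- A simple algebra of prime left dimension over a division subring is either a division ring or
has a left ideal of dimension one. -/
theorem isSimpleModule_or_exists_of_finrank_prime {D : Type v} {A : Type w} [DivisionRing D]
    [Ring A] [IsSimpleRing A] [Module D A] [IsScalarTower D A A] [Module.Finite D A]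
    (hp : (Module.finrank D A).Prime) :
    IsSimpleModule A A ∨ ∃ v : A, v ≠ 0 ∧ ∀ a : A, ∃ d : D, a * v = d • v := by
  have : IsArtinianRing A := isArtinian_of_tower D inferInstance
  obtain ⟨n, _, I, hI, ⟨e⟩⟩ := (IsSimpleRing.isIsotypic A A).linearEquiv_fun
  have hfin : Module.Finite D I :=
    Module.Finite.of_injective (I.subtype.restrictScalars D) I.subtype_injective
  have hrank : Module.finrank D A = n * Module.finrank D I := by
    rw [(e.restrictScalars D).finrank_eq, Module.finrank_pi_fintype]
    simp
  -- `A` is a sum of `n` copies of a minimal left ideal `I`, so primality of `n * dim I` leaves only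
  -- `dim I = 1` or `n = 1`.
  rw [hrank, Nat.prime_mul_iff] at hp
  rcases hp with ⟨_, h1⟩ | ⟨_, h1⟩
  · right
    have := hI.nontrivial
    obtain ⟨v, hv⟩ := exists_ne (0 : I)
    refine ⟨v, fun h => hv (Subtype.ext h), fun a => ?_⟩
    obtain ⟨d, hd⟩ := (finrank_eq_one_iff_of_nonzero' v hv).1 h1 (a • v)
    exact ⟨d, (congrArg Subtype.val hd).symm⟩
  · left
    subst h1
    exact IsSimpleModule.congr (e.trans (LinearEquiv.funUnique (Fin 1) A I))

end Division

section DivisionAlgebra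

theorem isDivisionAlgebra_iff_isUnit {A : Type v} [Ring A] :
    IsDivisionAlgebra A ↔ Nontrivial A ∧ ∀ a : A, a ≠ 0 → IsUnit a := by
  refine and_congr_right fun _ => forall₂_congr fun a _ => ⟨fun ⟨h, h'⟩ => ?_, ?_⟩
  · obtain ⟨x, hx⟩ := h.2 1
    obtain ⟨y, hy⟩ := h'.2 1
    exact isUnit_iff_exists_and_exists.2 ⟨⟨x, hx⟩, ⟨y, hy⟩⟩
  · rintro ⟨u, rfl⟩
    exact ⟨u.mulLeft_bijective, u.mulRight_bijective⟩

theorem isDivisionAlgebra_of_divisionRing (D : Type v) [DivisionRing D] : IsDivisionAlgebra D :=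
  isDivisionAlgebra_iff_isUnit.2 ⟨inferInstance, fun _ h => h.isUnit⟩

section TwistedNorm

variable {F : Type u} [Field F] {S : Type v} [Ring S] [Algebra F S] {A : Type w} [Ring A]
  [Algebra F A] {τ : S ≃ₐ[F] S} {f : S →ₐ[F] A} {t : A}

theorem pow_mul_eq_twistedNorm_mul (ht : ∀ s, t * f s = f (τ s) * t) {z : S} {v : A}
    (h : t * v = f z * v) (m : ℕ) : t ^ m * v = f (twistedNorm τ z m) * v := by
  induction m with
  | zero => simp [twistedNorm]
  | succ m ih =>
    rw [pow_succ, mul_assoc, h, ← mul_assoc, pow_mul_apply ht, mul_assoc, ih,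
      twistedNorm, map_mul, mul_assoc]

end TwistedNorm

/-- A one-dimensional left ideal `D v` would give `t v = z v`. Comparing `t ^ q v = c v` with its
value as twisted norm times `v` then yields the excluded equality. -/
theorem isSimpleModule_of_twistedNorm_ne {F : Type u} [Field F] {D : Type v} [DivisionRing D]
    [Algebra F D] {A : Type w} [Ring A] [Algebra F A] [IsSimpleRing A] {τ : D ≃ₐ[F] D}
    {f : D →ₐ[F] A} {t : A} (ht : ∀ d, t * f d = f (τ d) * t) {q : ℕ} (hq : q.Prime) {c : D}
    (hc : t ^ q = f c)
    (hbij : Function.Bijective fun s : Fin q → D => ∑ j, f (s j) * t ^ (j : ℕ))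
    (hnorm : ∀ z, twistedNorm τ z q ≠ c) : IsSimpleModule A A := by
  let : Module D A := Module.compHom A f.toRingHom
  have hsmul (d : D) (a : A) : d • a = f d * a := rfl
  have : IsScalarTower D A A := ⟨fun d a b => by simp only [hsmul, smul_eq_mul, mul_assoc]⟩
  let g : (Fin q → D) →ₗ[D] A :=
    { toFun := fun s => ∑ j, f (s j) * t ^ (j : ℕ)
      map_add' := fun s s' => by simp [add_mul, Finset.sum_add_distrib]
      map_smul' := fun d s => by simp [hsmul, Finset.mul_sum, mul_assoc] }
  let e : (Fin q → D) ≃ₗ[D] A := LinearEquiv.ofBijective g hbij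
  have : Module.Finite D A := Module.Finite.equiv e
  have hrank : Module.finrank D A = q := by
    rw [← e.finrank_eq]; simp
  refine (isSimpleModule_or_exists_of_finrank_prime (D := D) (hrank.symm ▸ hq)).resolve_right ?_
  rintro ⟨v, hv, hd⟩
  obtain ⟨z, hz⟩ := hd t
  have h := pow_mul_eq_twistedNorm_mul ht hz q
  rw [hc, ← sub_eq_zero, ← sub_mul, ← map_sub, ← hsmul] at h
  exact hnorm z (sub_eq_zero.1 ((smul_eq_zero.1 h).resolve_right hv)).symm

theorem isDivisionAlgebra_cyclicQuot {F : Type u} [Field F] {S : Type v} [Ring S]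
    [Algebra F S] {τ : S ≃ₐ[F] S} {q : ℕ} {c : S} (hS : IsDivisionAlgebra S) (hq : q.Prime)
    (hinv : IsRightInvariant (binom τ q c)) (hsimple : IsSimpleRing (CyclicQuot τ q c))
    (hnorm : ∀ z, twistedNorm τ z q ≠ c) : IsDivisionAlgebra (CyclicQuot τ q c) := by
  rw [isDivisionAlgebra_iff_isUnit] at hS ⊢
  have := hS.1
  rw [← isSimpleModule_self_iff_isUnit]
  exact @isSimpleModule_of_twistedNorm_ne F _ S
    (DivisionRing.ofIsUnitOrEqZero fun a => or_iff_not_imp_right.2 (hS.2 a)) _ _ _ _ hsimple τ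
    (ofCoeff τ q c) (gen τ q c) (gen_mul_ofCoeff τ q c) q hq c (gen_pow τ q c)
    ⟨combine_injective hq.pos hinv, combine_surjective hq.pos⟩ hnorm

end DivisionAlgebra

/-! ### Commutation relations in the levels of the tower -/

section Levels

variable {F : Type u} {M : Type v} [Field F] [Field M] [Algebra F M]

/-- The relations between `M`, the elements `t j` with `j < i`, and the automorphisms `H_ρ` in a
level that is generated by `M` and these elements. -/
structure Level.IsGenerated (L : Level F M) (σ : ℕ → Gal(M/F)) (i : ℕ) : Prop where
  act_ofField : ∀ ρ m, L.act ρ (L.ofField m) = L.ofField (ρ m)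
  t_mul : ∀ j < i, ∀ m, L.t j * L.ofField m = L.ofField (σ j m) * L.t j
  -- No bound on the indices is needed, since in the tower the elements not yet reached are `1`.
  t_comm : ∀ j j', Commute (L.t j) (L.t j')
  isUnit_t : ∀ j, IsUnit (L.t j)
  mem_of_mem : ∀ P : Subalgebra F L.A, (∀ m, L.ofField m ∈ P) → (∀ j < i, L.t j ∈ P) → ∀ a, a ∈ P

theorem Level.isGenerated_base (σ : ℕ → Gal(M/F)) : (Level.base : Level F M).IsGenerated σ 0 where
  act_ofField _ _ := rfl
  t_mul j hj := absurd hj (Nat.not_lt_zero j)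
  t_comm _ _ := Commute.one_left 1
  isUnit_t _ := isUnit_one
  mem_of_mem _ h _ := h

section Element

variable {L : Level F M} {σ : ℕ → Gal(M/F)} {i : ℕ}

theorem Level.IsGenerated.isUnit_element (h : L.IsGenerated σ i) (l : Fˣ) (e : ℕ → ℕ) :
    IsUnit (L.element l e i) := by
  refine (l.isUnit.map (algebraMap F L.A)).mul ?_
  refine Submonoid.list_prod_mem (IsUnit.submonoid L.A) fun x hx => ?_
  obtain ⟨j, _, rfl⟩ := List.mem_map.1 hx
  exact (h.isUnit_t j).pow _

theorem Level.IsGenerated.commute_element (h : L.IsGenerated σ i) (l : F) (e : ℕ → ℕ) (j : ℕ) :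
    Commute (L.element l e i) (L.t j) := by
  refine Commute.mul_left (Algebra.commutes l _) (Commute.list_prod_left _ _ fun x hx => ?_)
  obtain ⟨j', _, rfl⟩ := List.mem_map.1 hx
  exact (h.t_comm j' j).pow_left _

theorem Level.IsGenerated.element_mul_ofField (h : L.IsGenerated σ i) (l : F) (e : ℕ → ℕ) (m : M) :
    L.element l e i * L.ofField m
      = L.ofField (((List.range i).map fun j => σ j ^ e j).prod m) * L.element l e i := by
  have hpow (j : ℕ) (hj : j < i) (n : ℕ) (m : M) :
      L.t j ^ n * L.ofField m = L.ofField ((σ j ^ n) m) * L.t j ^ n :=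
    pow_mul_apply (h.t_mul j hj) n m
  have key (s : List ℕ) (hs : ∀ j ∈ s, j < i) (m : M) :
      (s.map fun j => L.t j ^ e j).prod * L.ofField m
        = L.ofField ((s.map fun j => σ j ^ e j).prod m) * (s.map fun j => L.t j ^ e j).prod := by
    induction s generalizing m with
    | nil => simp
    | cons j s ih =>
      rw [List.map_cons, List.prod_cons, List.map_cons, List.prod_cons, mul_assoc,
        ih fun j' hj' => hs j' (List.mem_cons_of_mem _ hj'), ← mul_assoc,
        hpow j (hs j List.mem_cons_self), mul_assoc]
      rfl
  rw [Level.element, mul_assoc, key _ (fun j hj => List.mem_range.1 hj), ← mul_assoc,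
    Algebra.commutes, mul_assoc]

/-- The elements `a` for which this holds form a subalgebra, so it suffices to check `M` and the
`tⱼ`. -/
theorem Level.IsGenerated.act_mul_element (h : L.IsGenerated σ i) (l : F) (e : ℕ → ℕ) (a : L.A) :
    L.act ((List.range i).map fun j => σ j ^ e j).prod a * L.element l e i
      = L.element l e i * a := by
  set ρ := ((List.range i).map fun j => σ j ^ e j).prod with hρ
  set c := L.element l e i with hc
  let P : Subalgebra F L.A :=
    { carrier := {a | L.act ρ a * c = c * a}
      mul_mem' := fun {a b} ha hb => by
        change L.act ρ (a * b) * c = c * (a * b)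
        rw [map_mul, mul_assoc, hb, ← mul_assoc, ha, mul_assoc]
      add_mem' := fun {a b} ha hb => by
        change L.act ρ (a + b) * c = c * (a + b)
        rw [map_add, add_mul, mul_add, ha, hb]
      algebraMap_mem' := fun r => by
        change L.act ρ (algebraMap F L.A r) * c = c * algebraMap F L.A r
        rw [AlgEquiv.commutes, Algebra.commutes] }
  refine h.mem_of_mem P (fun m => ?_) (fun j _ => ?_) a
  · change L.act ρ (L.ofField m) * c = c * L.ofField m
    rw [h.act_ofField, h.element_mul_ofField]
  · change L.act ρ (L.t j) * c = c * L.t j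
    rw [L.act_t, (h.commute_element l e j).eq]

end Element

variable [IsMulCommutative Gal(M/F)]

/-- The canonical map from a level `A` to `A[t; H_σ] / (t ^ q - c)`. -/
noncomputable def Level.adjoinMap (L : Level F M) (i : ℕ) (σ : Gal(M/F)) (q : ℕ) (c : L.A)
    (hc : ∀ ρ, L.act ρ c = c) : L.A →ₐ[F] (L.adjoin i σ q c hc).A :=
  ofCoeff (L.act σ) q c

section Adjoin

variable (L : Level F M) {i : ℕ} (σ : Gal(M/F)) (q : ℕ) (c : L.A) (hc : ∀ ρ, L.act ρ c = c)

theorem Level.adjoin_t_self : (L.adjoin i σ q c hc).t i = gen (L.act σ) q c :=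
  Function.update_self (β := fun _ => CyclicQuot (L.act σ) q c) i (gen (L.act σ) q c)
    fun j => ofCoeff (L.act σ) q c (L.t j)

theorem Level.adjoin_t_of_ne {j : ℕ} (hj : j ≠ i) :
    (L.adjoin i σ q c hc).t j = L.adjoinMap i σ q c hc (L.t j) :=
  Function.update_of_ne (β := fun _ => CyclicQuot (L.act σ) q c) hj (gen (L.act σ) q c)
    fun j => ofCoeff (L.act σ) q c (L.t j)

theorem Level.adjoin_t_mul (a : L.A) : (L.adjoin i σ q c hc).t i * L.adjoinMap i σ q c hc a
    = L.adjoinMap i σ q c hc (L.act σ a) * (L.adjoin i σ q c hc).t i := by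
  rw [L.adjoin_t_self]
  exact gen_mul_ofCoeff _ q c a

theorem Level.adjoin_ofField (m : M) :
    (L.adjoin i σ q c hc).ofField m = L.adjoinMap i σ q c hc (L.ofField m) := rfl

theorem Level.adjoin_act (ρ : Gal(M/F)) (a : L.A) :
    (L.adjoin i σ q c hc).act ρ (L.adjoinMap i σ q c hc a)
      = L.adjoinMap i σ q c hc (L.act ρ a) :=
  L.extend_ofCoeff σ q c hc ρ a

end Adjoin

theorem Level.IsGenerated.adjoin {L : Level F M} {σ : ℕ → Gal(M/F)} {i : ℕ}
    (h : L.IsGenerated σ i) {q : ℕ} (hq : 0 < q) {c : L.A} (hc : ∀ ρ, L.act ρ c = c)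
    (hu : IsUnit c) : (L.adjoin i (σ i) q c hc).IsGenerated σ (i + 1) where
  act_ofField ρ m := by
    rw [L.adjoin_ofField, L.adjoin_ofField, L.adjoin_act, h.act_ofField]
  t_mul j hj m := by
    rw [L.adjoin_ofField, L.adjoin_ofField]
    rcases eq_or_ne j i with rfl | hne
    · rw [L.adjoin_t_mul, h.act_ofField]
    · rw [L.adjoin_t_of_ne _ _ _ _ hne, ← map_mul, ← map_mul, h.t_mul j (by omega)]
  t_comm j j' := by
    have key (j : ℕ) : Commute ((L.adjoin i (σ i) q c hc).t i)
        (L.adjoinMap i (σ i) q c hc (L.t j)) := by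
      rw [commute_iff_eq, L.adjoin_t_mul, L.act_t]
    by_cases hj : j = i <;> by_cases hj' : j' = i
    · rw [hj, hj']
    · rw [hj, L.adjoin_t_of_ne _ _ _ _ hj']
      exact key j'
    · rw [hj', L.adjoin_t_of_ne _ _ _ _ hj]
      exact (key j).symm
    · rw [L.adjoin_t_of_ne _ _ _ _ hj, L.adjoin_t_of_ne _ _ _ _ hj']
      exact (h.t_comm j j').map _
  isUnit_t j := by
    rcases eq_or_ne j i with rfl | hj
    · rw [L.adjoin_t_self]
      exact isUnit_gen hq hu
    · rw [L.adjoin_t_of_ne _ _ _ _ hj]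
      exact (h.isUnit_t j).map _
  mem_of_mem P hM ht a := by
    obtain ⟨s, hs⟩ := combine_surjective hq a
    have hsum : a = ∑ j, L.adjoinMap i (σ i) q c hc (s j)
        * (L.adjoin i (σ i) q c hc).t i ^ (j : ℕ) := by
      rw [← hs, L.adjoin_t_self]
      rfl
    rw [hsum]
    refine sum_mem fun j _ => mul_mem ?_ (pow_mem (ht i (by omega)) _)
    -- The coefficients lie in the old level, so its generation property is applied to the preimage
    -- of `P`.
    refine h.mem_of_mem (P.comap (L.adjoinMap i (σ i) q c hc)) hM (fun j' hj' => ?_) (s j)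
    have := ht j' (by omega)
    rwa [L.adjoin_t_of_ne _ _ _ _ hj'.ne] at this

end Levels

/-! ### Centres of the levels as fixed fields -/

section GaloisLevels

variable {F : Type u} {M : Type v} [Field F] [Field M] [Algebra F M]

/-- A level whose algebra is simple with centre the fixed field of `H`, and of dimension `n` over
`M`. -/
structure Level.IsSimpleLevel (L : Level F M) (σ : ℕ → Gal(M/F)) (i : ℕ) (H : Subgroup Gal(M/F))
    (n : ℕ) : Prop extends L.IsGenerated σ i where
  simple : IsSimpleRing L.A
  finite : Module.Finite F L.A
  mem_center_iff : ∀ x : L.A,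
    x ∈ Subalgebra.center F L.A ↔ ∃ m, (∀ g ∈ H, g m = m) ∧ L.ofField m = x
  finrank_eq : Module.finrank F L.A = n * Module.finrank F M

theorem Level.isSimpleLevel_base [FiniteDimensional F M] (σ : ℕ → Gal(M/F)) :
    (Level.base : Level F M).IsSimpleLevel σ 0 ⊥ 1 where
  __ := Level.isGenerated_base σ
  simple := inferInstanceAs (IsSimpleRing M)
  finite := inferInstanceAs (Module.Finite F M)
  mem_center_iff x := by
    refine ⟨fun _ => ⟨x, ?_, rfl⟩, fun _ => ?_⟩
    · rintro g rfl
      rfl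
    · exact Subalgebra.mem_center_iff.2 fun b : M => mul_comm b (x : M)
  finrank_eq := (one_mul _).symm

section Step

variable {L : Level F M} {σ : ℕ → Gal(M/F)} {i : ℕ} {H : Subgroup Gal(M/F)} {n : ℕ}

theorem Level.IsSimpleLevel.ofField_injective (h : L.IsSimpleLevel σ i H n) :
    Function.Injective L.ofField :=
  have := h.simple
  L.ofField.toRingHom.injective

/-- Galois correspondence: the centre is the fixed field of `H`, and only elements of `H` act
trivially on that. -/
theorem Level.IsSimpleLevel.mem_of_act_center [FiniteDimensional F M]
    (h : L.IsSimpleLevel σ i H n) {ρ : Gal(M/F)}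
    (hρ : ∀ z ∈ Subalgebra.center F L.A, L.act ρ z = z) : ρ ∈ H := by
  rw [← IntermediateField.fixingSubgroup_fixedField H, IntermediateField.mem_fixingSubgroup_iff]
  intro m hm
  refine h.ofField_injective ?_
  rw [← h.act_ofField]
  exact hρ _ ((h.mem_center_iff _).2 ⟨m, fun g hg => hm ⟨g, hg⟩, rfl⟩)

theorem Level.IsSimpleLevel.exists_center_ne [FiniteDimensional F M]
    (h : L.IsSimpleLevel σ i H n) {q : ℕ} (hσ : ∀ m, 0 < m → m < q → σ i ^ m ∉ H) (m : ℕ)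
    (hm : 0 < m) (hmq : m < q) :
    ∃ z ∈ Subalgebra.center F L.A, (L.act (σ i) ^ m) z ≠ z := by
  by_contra! hz
  refine hσ m hm hmq (h.mem_of_act_center fun z hz' => ?_)
  rw [map_pow]
  exact hz z hz'

variable {q : ℕ} {e : ℕ → ℕ} (l : Fˣ)

theorem Level.IsGenerated.act_pow_mul_element (h : L.IsGenerated σ i)
    (hpow : σ i ^ q = ((List.range i).map fun j => σ j ^ e j).prod) (a : L.A) :
    (L.act (σ i) ^ q) a * L.element l e i = L.element l e i * a := by
  rw [← map_pow, hpow, h.act_mul_element]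

theorem Level.IsGenerated.isInner_act_pow (h : L.IsGenerated σ i)
    (hpow : σ i ^ q = ((List.range i).map fun j => σ j ^ e j).prod) :
    IsInner (L.act (σ i) ^ q) := by
  -- The scalar `l` is central and does not affect conjugation, so `l = 1` will do.
  obtain ⟨u, hu⟩ := h.isUnit_element 1 e
  refine ⟨u, fun a => ?_⟩
  rw [Units.eq_mul_inv_iff_mul_eq, hu]
  exact h.act_pow_mul_element 1 hpow a

/-- This bounds the inner order below by the order on the centre. -/
theorem act_eq_of_isInner {S : Type v} [Ring S] [Algebra F S] {φ : S ≃ₐ[F] S} (h : IsInner φ)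
    {z : S} (hz : z ∈ Subalgebra.center F S) : φ z = z := by
  obtain ⟨u, hu⟩ := h
  rw [hu, Subalgebra.mem_center_iff.1 hz, Units.mul_inv_cancel_right]

theorem Level.IsGenerated.isRightInvariant (h : L.IsGenerated σ i)
    (hpow : σ i ^ q = ((List.range i).map fun j => σ j ^ e j).prod) :
    IsRightInvariant (binom (L.act (σ i)) q (L.element l e i)) :=
  isRightInvariant_binom (L.act_element l e i (σ i)) (h.act_pow_mul_element l hpow)

theorem Level.IsSimpleLevel.isGeneralisedCyclic [FiniteDimensional F M]
    (h : L.IsSimpleLevel σ i H n) (hq : 0 < q) (hσ : ∀ m, 0 < m → m < q → σ i ^ m ∉ H)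
    (hpow : σ i ^ q = ((List.range i).map fun j => σ j ^ e j).prod) :
    IsGeneralisedCyclic (L.act (σ i)) q (L.element l e i) where
  simple := h.simple
  finite := have := h.finite; Module.Finite.of_restrictScalars_finite F _ _
  order := by
    refine ⟨⟨hq, fun z hz => act_eq_of_isInner (h.isInner_act_pow hpow) hz⟩, ?_⟩
    rintro m ⟨hm, hfix⟩
    by_contra! hlt
    obtain ⟨z, hz, hne⟩ := h.exists_center_ne hσ m hm hlt
    exact hne (hfix z hz)
  isUnit := h.isUnit_element l e
  fixed := L.act_element l e i (σ i)
  rightInvariant := h.isRightInvariant l hpow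

theorem Level.IsSimpleLevel.hasInnerOrder [FiniteDimensional F M]
    (h : L.IsSimpleLevel σ i H n) (hq : 0 < q) (hσ : ∀ m, 0 < m → m < q → σ i ^ m ∉ H)
    (hpow : σ i ^ q = ((List.range i).map fun j => σ j ^ e j).prod) :
    HasInnerOrder (L.act (σ i)) q := by
  refine ⟨⟨hq, h.isInner_act_pow hpow⟩, ?_⟩
  rintro m ⟨hm, hinner⟩
  by_contra! hlt
  obtain ⟨z, hz, hne⟩ := h.exists_center_ne hσ m hm hlt
  exact hne (act_eq_of_isInner hinner hz)

theorem forall_mem_sup_zpowers_iff (H : Subgroup Gal(M/F)) (ρ : Gal(M/F)) (m : M) :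
    (∀ g ∈ H ⊔ Subgroup.zpowers ρ, g m = m) ↔ (∀ g ∈ H, g m = m) ∧ ρ m = m := by
  change H ⊔ Subgroup.zpowers ρ ≤ MulAction.stabilizer Gal(M/F) m
    ↔ H ≤ MulAction.stabilizer Gal(M/F) m ∧ ρ ∈ MulAction.stabilizer Gal(M/F) m
  rw [sup_le_iff, Subgroup.zpowers_le]

theorem Level.IsSimpleLevel.center_inf_fixed (h : L.IsSimpleLevel σ i H n) (x : L.A) :
    (x ∈ Subalgebra.center F L.A ∧ L.act (σ i) x = x) ↔
      ∃ m, (∀ g ∈ H ⊔ Subgroup.zpowers (σ i), g m = m) ∧ L.ofField m = x := by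
  simp only [forall_mem_sup_zpowers_iff]
  rw [h.mem_center_iff]
  constructor
  · rintro ⟨⟨m, hm, rfl⟩, hx⟩
    rw [h.act_ofField] at hx
    exact ⟨m, ⟨hm, h.ofField_injective hx⟩, rfl⟩
  · rintro ⟨m, ⟨hm, hσ⟩, rfl⟩
    exact ⟨⟨m, hm, rfl⟩, by rw [h.act_ofField, hσ]⟩

variable [IsMulCommutative Gal(M/F)]

theorem Level.IsSimpleLevel.adjoin [FiniteDimensional F M]
    (h : L.IsSimpleLevel σ i H n) (hq : 0 < q) (hσ : ∀ m, 0 < m → m < q → σ i ^ m ∉ H)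
    (hpow : σ i ^ q = ((List.range i).map fun j => σ j ^ e j).prod) :
    (L.adjoin i (σ i) q (L.element l e i) (L.act_element l e i)).IsSimpleLevel σ (i + 1)
      (H ⊔ Subgroup.zpowers (σ i)) (n * q) where
  __ := h.toIsGenerated.adjoin hq (L.act_element l e i) (h.isUnit_element l e)
  simple :=
    have := h.simple
    isSimpleRing_cyclicQuot hq (h.isUnit_element l e) (h.isRightInvariant l hpow)
      (h.exists_center_ne hσ)
  finite := have := h.finite; finite_cyclicQuot hq
  mem_center_iff x := by
    have := h.simple
    refine (mem_center_cyclicQuot_iff hq (h.isRightInvariant l hpow) (h.exists_center_ne hσ)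
      (h.isUnit_element l e)).trans ?_
    constructor
    · rintro ⟨s, hs, hfix, rfl⟩
      obtain ⟨m, hm, rfl⟩ := (h.center_inf_fixed s).1 ⟨hs, hfix⟩
      exact ⟨m, hm, rfl⟩
    · rintro ⟨m, hm, rfl⟩
      obtain ⟨hs, hfix⟩ := (h.center_inf_fixed (L.ofField m)).2 ⟨m, hm, rfl⟩
      exact ⟨_, hs, hfix, rfl⟩
  finrank_eq := by
    have := h.finite
    refine (finrank_cyclicQuot hq (h.isRightInvariant l hpow)).trans ?_
    rw [h.finrank_eq, mul_comm n q, mul_assoc]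

end Step

end GaloisLevels

/-! ### Group theory of the chain of subgroups -/

section Chain

variable {Γ : Type v} [Group Γ] {k : ℕ} {G : ℕ → Subgroup Γ} {q : ℕ → ℕ} {σ : ℕ → Γ}

theorem generator_mem_chain (hgen : ∀ i < k, G (i + 1) = G i ⊔ Subgroup.zpowers (σ i)) {i : ℕ}
    (hi : i ≤ k) {j : ℕ} (hj : j < i) : σ j ∈ G i := by
  induction i with
  | zero => omega
  | succ i ih =>
    rw [hgen i hi]
    rcases Nat.lt_succ_iff_lt_or_eq.1 hj with h | rfl
    · exact Subgroup.mem_sup_left (ih (by omega) h)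
    · exact Subgroup.mem_sup_right (Subgroup.mem_zpowers _)

/-- By Bézout, `σᵢ ^ m` and `σᵢ ^ qᵢ` in `Gᵢ` with `m` prime to `qᵢ` would put `σᵢ` in `Gᵢ`, making
the index `1`. -/
theorem pow_notMem_chain (hq : ∀ i < k, (q i).Prime)
    (hindex : ∀ i < k, (G i).relIndex (G (i + 1)) = q i)
    (hgen : ∀ i < k, G (i + 1) = G i ⊔ Subgroup.zpowers (σ i)) {i : ℕ} (hi : i < k)
    (hpow : σ i ^ q i ∈ G i) (m : ℕ) (hm : 0 < m) (hmq : m < q i) : σ i ^ m ∉ G i := by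
  intro hmem
  have hgcd : σ i ^ (Nat.gcd m (q i) : ℤ) ∈ G i := by
    rw [Nat.gcd_eq_gcd_ab, zpow_add, zpow_mul, zpow_mul, zpow_natCast, zpow_natCast]
    exact mul_mem (zpow_mem hmem _) (zpow_mem hpow _)
  rw [Nat.gcd_comm, Nat.coprime_of_lt_prime hm.ne' hmq (hq i hi), Nat.cast_one, zpow_one] at hgcd
  have hle : G (i + 1) ≤ G i := by
    rw [hgen i hi, sup_le_iff, Subgroup.zpowers_le]
    exact ⟨le_rfl, hgcd⟩
  have := hindex i hi
  rw [Subgroup.relIndex_eq_one.2 hle] at this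
  exact (hq i hi).one_lt.ne this

theorem card_chain (hG₀ : G 0 = ⊥) (hle : ∀ i < k, G i ≤ G (i + 1))
    (hindex : ∀ i < k, (G i).relIndex (G (i + 1)) = q i) {i : ℕ} (hi : i ≤ k) :
    Nat.card (G i) = ∏ j ∈ Finset.range i, q j := by
  induction i with
  | zero => rw [hG₀]; simp
  | succ i ih =>
    rw [Finset.prod_range_succ, ← ih (by omega), ← hindex i hi, ← Subgroup.relIndex_bot_left,
      ← Subgroup.relIndex_bot_left, Subgroup.relIndex_mul_relIndex _ _ _ bot_le (hle i hi)]

end Chain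

/-! ### The tower attached to the chain -/

section MainTower

variable {F : Type u} {M : Type v} [Field F] [Field M] [Algebra F M]

theorem pow_mem_chain {k : ℕ} {G : ℕ → Subgroup Gal(M/F)} {q : ℕ → ℕ} {σ : ℕ → Gal(M/F)}
    (hgen : ∀ i < k, G (i + 1) = G i ⊔ Subgroup.zpowers (σ i)) {e : ℕ → ℕ → ℕ}
    (hpow : ∀ i < k, σ i ^ q i = ((List.range i).map fun j => σ j ^ e i j).prod)
    {i : ℕ} (hi : i < k) : σ i ^ q i ∈ G i := by
  rw [hpow i hi]
  refine Subgroup.list_prod_mem _ fun x hx => ?_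
  obtain ⟨j, hj, rfl⟩ := List.mem_map.1 hx
  exact pow_mem (generator_mem_chain hgen hi.le (List.mem_range.1 hj)) _

theorem forall_mem_chain_iff {k : ℕ} {G : ℕ → Subgroup Gal(M/F)} {σ : ℕ → Gal(M/F)}
    (hG₀ : G 0 = ⊥) (hgen : ∀ i < k, G (i + 1) = G i ⊔ Subgroup.zpowers (σ i)) (m : M)
    {i : ℕ} (hi : i ≤ k) : (∀ g ∈ G i, g m = m) ↔ ∀ j < i, σ j m = m := by
  induction i with
  | zero => simp [hG₀]
  | succ i ih =>
    rw [hgen i hi, forall_mem_sup_zpowers_iff, ih (by omega), Nat.forall_lt_succ_right]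

variable [IsMulCommutative Gal(M/F)] [FiniteDimensional F M]

theorem isSimpleLevel_tower {k : ℕ} {G : ℕ → Subgroup Gal(M/F)} {q : ℕ → ℕ} {σ : ℕ → Gal(M/F)}
    (hG₀ : G 0 = ⊥) (hq : ∀ i < k, 0 < q i)
    (hgen : ∀ i < k, G (i + 1) = G i ⊔ Subgroup.zpowers (σ i))
    (hσ : ∀ i < k, ∀ m, 0 < m → m < q i → σ i ^ m ∉ G i) {e : ℕ → ℕ → ℕ}
    (hpow : ∀ i < k, σ i ^ q i = ((List.range i).map fun j => σ j ^ e i j).prod)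
    (l : ℕ → Fˣ) {i : ℕ} (hi : i ≤ k) :
    (tower σ q e l i).IsSimpleLevel σ i (G i) (∏ j ∈ Finset.range i, q j) := by
  induction i with
  | zero => rw [hG₀]; exact Level.isSimpleLevel_base σ
  | succ i ih =>
    rw [hgen i hi, Finset.prod_range_succ]
    exact (ih (by omega)).adjoin (l i) (hq i hi) (hσ i hi) (hpow i hi)

end MainTower

end CyclicTower

theorem mainTheorem12 {F : Type u} {M : Type v} [Field F] [Field M] [Algebra F M]
    [FiniteDimensional F M] [IsAbelianGalois F M]
    -- a chain `1 = G₀ ≤ ⋯ ≤ Gₖ = Gal(M/F)` with `Gᵢ₊₁ / Gᵢ` cyclic of prime order `qᵢ`,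
    -- generated by the class of `σᵢ`
    (k : ℕ) (G : ℕ → Subgroup Gal(M/F)) (q : ℕ → ℕ) (σ : ℕ → Gal(M/F))
    (hG₀ : G 0 = ⊥) (hGk : G k = ⊤)
    (hq : ∀ i < k, (q i).Prime)
    (hle : ∀ i < k, G i ≤ G (i + 1))
    (hindex : ∀ i < k, (G i).relIndex (G (i + 1)) = q i)
    (hgen : ∀ i < k, G (i + 1) = G i ⊔ Subgroup.zpowers (σ i))
    -- the expression of `σᵢ ^ qᵢ` through `σ₀, …, σᵢ₋₁`
    (e : ℕ → ℕ → ℕ) (he : ∀ i < k, ∀ j < i, e i j < q j)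
    (hpow : ∀ i < k, σ i ^ q i = ((List.range i).map fun j => σ j ^ e i j).prod)
    (l : ℕ → Fˣ) :
    -- each step of the tower
    (∀ i < k,
      (∀ m : M, tau σ q e l i (incl σ q e l i m)
        = incl σ q e l i (σ i m)) ∧
      IsGeneralisedCyclic
        (tau σ q e l i) (q i) (elt σ q e l i) ∧
      HasInnerOrder (tau σ q e l i) (q i) ∧
      Function.Injective (inclSucc σ q e l i) ∧
      (∀ x : Alg σ q e l i,
        (x ∈ Subalgebra.center F (Alg σ q e l i) ∧ tau σ q e l i x = x) ↔
          ∃ m : M, (∀ j ≤ i, σ j m = m) ∧ incl σ q e l i m = x)) ∧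
    (∀ i ≤ k, Module.finrank F (Alg σ q e l i)
      = (∏ j ∈ Finset.range i, q j) * Module.finrank F M) ∧
    -- the top of the tower
    Algebra.IsCentral F (Alg σ q e l k) ∧
    Module.finrank F (Alg σ q e l k) = Module.finrank F M ^ 2 ∧
    Function.Injective (incl σ q e l k) ∧
    -- the division algebra criterion
    (∀ i ≤ k,
      (∀ j < i, ∀ z : Alg σ q e l j,
        twistedNorm (tau σ q e l j) z (q j)
          ≠ elt σ q e l j) →
      IsDivisionAlgebra (Alg σ q e l i)) ∧
    ((∀ j < k, ∀ z : Alg σ q e l j,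
        twistedNorm (tau σ q e l j) z (q j)
          ≠ elt σ q e l j) →
      IsCrossedProduct (incl σ q e l k) ∧
      IsDivisionAlgebra (Alg σ q e l k)) := by
  have hqpos : ∀ i < k, 0 < q i := fun i hi => (hq i hi).pos
  have hσ : ∀ i < k, ∀ m, 0 < m → m < q i → σ i ^ m ∉ G i := fun i hi =>
    pow_notMem_chain hq hindex hgen hi (pow_mem_chain hgen hpow hi)
  have hlevel : ∀ i ≤ k, (tower σ q e l i).IsSimpleLevel σ i (G i) (∏ j ∈ Finset.range i, q j) :=
    fun i hi => isSimpleLevel_tower hG₀ hqpos hgen hσ hpow l hi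
  have hcard : ∏ j ∈ Finset.range k, q j = Module.finrank F M := by
    rw [← card_chain hG₀ hle hindex le_rfl, hGk, Subgroup.card_top, IsGalois.card_aut_eq_finrank]
  have hcentral : Algebra.IsCentral F (Alg σ q e l k) := by
    refine ⟨fun x hx => ?_⟩
    obtain ⟨m, hm, rfl⟩ := ((hlevel k le_rfl).mem_center_iff x).1 hx
    rw [hGk] at hm
    -- A central element comes from some `m` fixed by all of `Gal(M/F)`, hence from `F`.
    obtain ⟨a, rfl⟩ := (IsGalois.mem_range_algebraMap_iff_fixed m).2 fun g => hm g trivial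
    rw [AlgHom.commutes]
    exact algebraMap_mem _ a
  have hrank : Module.finrank F (Alg σ q e l k) = Module.finrank F M ^ 2 := by
    rw [(hlevel k le_rfl).finrank_eq, hcard, sq]
  have hinj := (hlevel k le_rfl).ofField_injective
  have hdiv : ∀ i ≤ k, (∀ j < i, ∀ z : Alg σ q e l j,
      twistedNorm (tau σ q e l j) z (q j) ≠ elt σ q e l j) →
      IsDivisionAlgebra (Alg σ q e l i) := by
    intro i hi hnorm
    induction i with
    | zero =>
      have : IsDivisionAlgebra M := isDivisionAlgebra_of_divisionRing M
      exact this
    | succ i ih =>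
      exact isDivisionAlgebra_cyclicQuot
        (ih (by omega) fun j hj => hnorm j (by omega)) (hq i hi)
        ((hlevel i (by omega)).isRightInvariant (l i) (hpow i hi)) (hlevel (i + 1) hi).simple
        (hnorm i (by omega))
  refine ⟨fun i hi => ⟨?_, ?_, ?_, ?_, ?_⟩, fun i hi => (hlevel i hi).finrank_eq, hcentral, hrank,
    hinj, hdiv, fun h => ⟨⟨hcentral, (hlevel k le_rfl).simple, inferInstance, inferInstance,
      hrank, hinj⟩, hdiv k le_rfl h⟩⟩
  · exact (hlevel i hi.le).act_ofField (σ i)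
  · exact (hlevel i hi.le).isGeneralisedCyclic (l i) (hqpos i hi) (hσ i hi) (hpow i hi)
  · exact (hlevel i hi.le).hasInnerOrder (hqpos i hi) (hσ i hi) (hpow i hi)
  · have := (hlevel i hi.le).simple
    have := (hlevel (i + 1) hi).simple
    -- A ring homomorphism from a simple ring to a nontrivial ring is injective.
    exact (inclSucc σ q e l i).toRingHom.injective
  · intro x
    rw [(hlevel i hi.le).center_inf_fixed x, ← hgen i hi]
    simp only [forall_mem_chain_iff hG₀ hgen _ (Nat.succ_le_of_lt hi), Nat.lt_succ_iff]
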